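/- Let $(M,g)$ be a $d$-dimensional spacetime: a smooth manifold with a smooth Lorentzian metric of signature $(-,+,\dots,+)$ and Levi-Civita connection $\nabla$. A null frame at a point is a basis $\ell,n,m_{(2)},\dots,m_{(d-1)}$ of the tangent space with $\ell_a\ell^a=n_an^a=\ell_am_{(i)}^a=n_am_{(i)}^a=0$, $\ell_an^a=1$, $m^{(i)}_am_{(j)}^a=\delta^i_j$; the boost weight of a frame component of a tensor is the number of its indices that refer to $\ell$ minus the number of those that refer to $n$. Assume that at every point the Weyl tensor is of type III or N, i.e. there is a null frame in which the highest boost weight of a non-vanishing component of the Weyl tensor is $-1$ (type III) or $-2$ (type N); the vector $\ell$ of such a frame spans the multiple Weyl aligned null direction. Assume further that the Ricci tensor has the form $$R_{ab}=\lambda g_{ab}+\eta\,k_ak_b$$ with a constant $\lambda$, a nowhere vanishing function $\eta$ and a nowhere vanishing null vector field $k$ (no regularity of $\eta$ and $k$ is required). Let $\ell$ be a $C^1$ vector field on an open set $V\subseteq M$ that spans the direction of $k$ at every point of $V$; in particular, $\ell$ may span the common aligned null direction of the Weyl and the Ricci tensors. Then $\ell$ is geodetic on $V$: $\kappa_i:=m_{(i)}^a\,\ell^b\nabla_b\ell_a=0$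 in every null frame $(\ell,n,m_{(i)})$ at every point of $V$, and $\ell^b\nabla_b\ell^a$ is proportional to $\ell^a$ at every point of $V$. -/

import Mathlib

open scoped Manifold ContDiff Bundle

noncomputable section

namespace Spacetime

/-! ### Tensor calculus in coordinates on (an open subset of) `ℝ^d` -/

/-- The partial derivative `∂_i f` at `y`. -/
def pd {d : ℕ} (i : Fin d) (f : EuclideanSpace ℝ (Fin d) → ℝ) (y : EuclideanSpace ℝ (Fin d)) : ℝ :=
  fderiv ℝ f y (EuclideanSpace.single i 1)

/-- The Christoffel symbols `Γ^a_{bc}` of the metric with components `G = (g_{ab})`. -/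
def christoffel {d : ℕ} (G : EuclideanSpace ℝ (Fin d) → Matrix (Fin d) (Fin d) ℝ)
    (a b c : Fin d) (y : EuclideanSpace ℝ (Fin d)) : ℝ :=
  (1 / 2) * ∑ s, (G y)⁻¹ a s *
    (pd b (fun z => G z s c) y + pd c (fun z => G z s b) y - pd s (fun z => G z b c) y)

/-- The Riemann tensor `R^a_{bce} = ∂_c Γ^a_{eb} - ∂_e Γ^a_{cb} + Γ^a_{cs} Γ^s_{eb} -
Γ^a_{es} Γ^s_{cb}`. -/
def riemann {d : ℕ} (G : EuclideanSpace ℝ (Fin d) → Matrix (Fin d) (Fin d) ℝ)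
    (a b c e : Fin d) (y : EuclideanSpace ℝ (Fin d)) : ℝ :=
  pd c (christoffel G a e b) y - pd e (christoffel G a c b) y
    + ∑ s, (christoffel G a c s y * christoffel G s e b y
      - christoffel G a e s y * christoffel G s c b y)

/-- The Ricci tensor `R_{be} = R^a_{bae}`. -/
def ricci {d : ℕ} (G : EuclideanSpace ℝ (Fin d) → Matrix (Fin d) (Fin d) ℝ)
    (b e : Fin d) (y : EuclideanSpace ℝ (Fin d)) : ℝ :=
  ∑ a, riemann G a b a e y

/-- The scalar curvature `R = g^{ab} R_{ab}`. -/
def scalarCurvature {d : ℕ} (G : EuclideanSpace ℝ (Fin d) → Matrix (Fin d) (Fin d) ℝ)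
    (y : EuclideanSpace ℝ (Fin d)) : ℝ :=
  ∑ a, ∑ b, (G y)⁻¹ a b * ricci G a b y

/-- The Weyl tensor `C_{abce}`, the trace-free part of the Riemann tensor `R_{abce}`. -/
def weyl {d : ℕ} (G : EuclideanSpace ℝ (Fin d) → Matrix (Fin d) (Fin d) ℝ)
    (a b c e : Fin d) (y : EuclideanSpace ℝ (Fin d)) : ℝ :=
  (∑ s, G y a s * riemann G s b c e y)
    - 1 / ((d : ℝ) - 2) * (G y a c * ricci G b e y - G y a e * ricci G b c y
        - G y b c * ricci G a e y + G y b e * ricci G a c y)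
    + scalarCurvature G y / (((d : ℝ) - 1) * ((d : ℝ) - 2))
        * (G y a c * G y b e - G y a e * G y b c)

/-! ### Lorentzian manifolds -/

/-- A smooth Lorentzian metric of signature `(-, +, …, +)` on the `d`-dimensional manifold `M`. -/
structure LorentzMetric (d : ℕ) (M : Type*) [TopologicalSpace M]
    [ChartedSpace (EuclideanSpace ℝ (Fin d)) M] [IsManifold (𝓡 d) ∞ M] where
  /-- The inner product on each tangent space. -/
  inner (p : M) : TangentSpace (𝓡 d) p →L[ℝ] TangentSpace (𝓡 d) p →L[ℝ] ℝ
  symm (p : M) (u v : TangentSpace (𝓡 d) p) : inner p u v = inner p v u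
  /-- Some vector is timelike, and the form is positive definite on its orthogonal complement. -/
  lorentzian (p : M) : ∃ t : TangentSpace (𝓡 d) p, inner p t t < 0 ∧
    ∀ v : TangentSpace (𝓡 d) p, v ≠ 0 → inner p t v = 0 → 0 < inner p v v
  contMDiff : ContMDiff (𝓡 d) ((𝓡 d).prod 𝓘(ℝ, EuclideanSpace ℝ (Fin d) →L[ℝ]
      EuclideanSpace ℝ (Fin d) →L[ℝ] ℝ)) ∞
    (fun p ↦ Bundle.TotalSpace.mk' (EuclideanSpace ℝ (Fin d) →L[ℝ]
      EuclideanSpace ℝ (Fin d) →L[ℝ] ℝ) p (inner p))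

section

variable {d : ℕ} {M : Type*} [TopologicalSpace M] [ChartedSpace (EuclideanSpace ℝ (Fin d)) M]

/-- The components `v^a` of a tangent vector `v` at `p` in the chart `e`. -/
def coord (e : OpenPartialHomeomorph M (EuclideanSpace ℝ (Fin d))) (p : M)
    (v : TangentSpace (𝓡 d) p) : EuclideanSpace ℝ (Fin d) :=
  mfderiv (𝓡 d) (𝓡 d) e p v

/-- The coordinate vector `∂_a` of the chart `e`, at the point with coordinates `y`. -/
def coordVec (e : OpenPartialHomeomorph M (EuclideanSpace ℝ (Fin d)))
    (y : EuclideanSpace ℝ (Fin d)) (a : Fin d) : TangentSpace (𝓡 d) (e.symm y) :=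
  mfderiv (𝓡 d) (𝓡 d) e.symm y (EuclideanSpace.single a (1 : ℝ) : EuclideanSpace ℝ (Fin d))

/-- The component `X^a` of a vector field, as a function of the coordinates of the chart `e`. -/
def fieldComp (e : OpenPartialHomeomorph M (EuclideanSpace ℝ (Fin d)))
    (X : (p : M) → TangentSpace (𝓡 d) p) (a : Fin d) (y : EuclideanSpace ℝ (Fin d)) : ℝ :=
  coord e (e.symm y) (X (e.symm y)) a

end

namespace LorentzMetric

variable {d : ℕ} {M : Type*} [TopologicalSpace M] [ChartedSpace (EuclideanSpace ℝ (Fin d)) M]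
  [IsManifold (𝓡 d) ∞ M]

/-- The components `g_{ab} = g(∂_a, ∂_b)` in the chart `e`. -/
def comp (g : LorentzMetric d M) (e : OpenPartialHomeomorph M (EuclideanSpace ℝ (Fin d)))
    (y : EuclideanSpace ℝ (Fin d)) : Matrix (Fin d) (Fin d) ℝ :=
  Matrix.of fun a b => g.inner (e.symm y) (coordVec e y a) (coordVec e y b)

/-- The value `Ric(u, v)` at `p`, computed in the chart `e`. -/
def ric (g : LorentzMetric d M) (e : OpenPartialHomeomorph M (EuclideanSpace ℝ (Fin d)))
    (p : M) (u v : TangentSpace (𝓡 d) p) : ℝ :=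
  ∑ a, ∑ b, ricci (g.comp e) a b (e p) * coord e p u a * coord e p v b

/-- The value `C(u, v, w, z)` of the Weyl tensor at `p`, computed in the chart `e`. -/
def weylAt (g : LorentzMetric d M) (e : OpenPartialHomeomorph M (EuclideanSpace ℝ (Fin d)))
    (p : M) (u v w z : TangentSpace (𝓡 d) p) : ℝ :=
  ∑ a, ∑ b, ∑ c, ∑ s, weyl (g.comp e) a b c s (e p)
    * coord e p u a * coord e p v b * coord e p w c * coord e p z s

/-- The covariant derivative `(∇_v X)^a = v^b ∂_b X^a + Γ^a_{bc} v^b X^c` at `p` along the tangent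
vector `v`, by its components in the chart `e`. -/
def covDeriv (g : LorentzMetric d M) (e : OpenPartialHomeomorph M (EuclideanSpace ℝ (Fin d)))
    (X : (p : M) → TangentSpace (𝓡 d) p) (p : M) (v : TangentSpace (𝓡 d) p) (a : Fin d) : ℝ :=
  ∑ b, coord e p v b * pd b (fieldComp e X a) (e p)
    + ∑ b, ∑ c, christoffel (g.comp e) a b c (e p) * coord e p v b * coord e p (X p) c

/-- `L(u, v) = u^a v^b ∇_b X_a = g(u, ∇_v X)` at `p`, computed in the chart `e`. -/
def covDerivForm (g : LorentzMetric d M)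
    (e : OpenPartialHomeomorph M (EuclideanSpace ℝ (Fin d)))
    (X : (p : M) → TangentSpace (𝓡 d) p) (p : M) (u v : TangentSpace (𝓡 d) p) : ℝ :=
  ∑ a, ∑ b, g.comp e (e p) a b * coord e p u a * g.covDeriv e X p v b

/-- A null vector: non-zero, with `g(v, v) = 0`. -/
def IsNull (g : LorentzMetric d M) (p : M) (v : TangentSpace (𝓡 d) p) : Prop :=
  v ≠ 0 ∧ g.inner p v v = 0

/-- `ℓ, n, m_2, …, m_{d-1}` is a null frame of the tangent space at `p`. -/
structure IsNullFrame (g : LorentzMetric d M) (p : M) (l n : TangentSpace (𝓡 d) p)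
    (m : Fin (d - 2) → TangentSpace (𝓡 d) p) : Prop where
  ll : g.inner p l l = 0
  nn : g.inner p n n = 0
  ln : g.inner p l n = 1
  lm : ∀ i, g.inner p l (m i) = 0
  nm : ∀ i, g.inner p n (m i) = 0
  mm : ∀ i j, g.inner p (m i) (m j) = if i = j then 1 else 0

end LorentzMetric

/-- The labels of the vectors of a null frame: `ℓ` (index 0), `n` (index 1), `m_i`. -/
inductive FrameIndex (d : ℕ) where
  | l : FrameIndex d
  | n : FrameIndex d
  | m (i : Fin (d - 2)) : FrameIndex d

namespace FrameIndex

/-- The contribution of one frame index to the boost weight of a frame component. -/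
def boostWeight {d : ℕ} : FrameIndex d → ℤ
  | l => 1
  | n => -1
  | m _ => 0

/-- The frame vector with the given label. -/
def vec {d : ℕ} {T : Type*} (l n : T) (m : Fin (d - 2) → T) : FrameIndex d → T
  | .l => l
  | .n => n
  | .m i => m i

end FrameIndex

namespace LorentzMetric

variable {d : ℕ} {M : Type*} [TopologicalSpace M] [ChartedSpace (EuclideanSpace ℝ (Fin d)) M]
  [IsManifold (𝓡 d) ∞ M]

/-- In the null frame `(ℓ, n, m_i)` at `p`, the highest boost weight of a non-vanishing component
of the Weyl tensor is exactly `r`. -/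
def WeylBoostOrder (g : LorentzMetric d M)
    (e : OpenPartialHomeomorph M (EuclideanSpace ℝ (Fin d))) (p : M)
    (l n : TangentSpace (𝓡 d) p) (m : Fin (d - 2) → TangentSpace (𝓡 d) p) (r : ℤ) : Prop :=
  IsGreatest {w : ℤ | ∃ A B C D : FrameIndex d,
    w = A.boostWeight + B.boostWeight + C.boostWeight + D.boostWeight ∧
    g.weylAt e p (A.vec l n m) (B.vec l n m) (C.vec l n m) (D.vec l n m) ≠ 0} r

/-- At `p`, the Weyl tensor is of (genuine) type III with multiple WAND `l`: in some null frame that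
contains `l` its components of boost weight `≥ 0` vanish and one of boost weight `-1` does not.
The components do not depend on the chart in which they are computed. -/
def IsWeylTypeIII (g : LorentzMetric d M) (p : M) (l : TangentSpace (𝓡 d) p) : Prop :=
  ∃ n m, g.IsNullFrame p l n m ∧
    ∀ e ∈ IsManifold.maximalAtlas (𝓡 d) ∞ M, p ∈ e.source → g.WeylBoostOrder e p l n m (-1)

/-- At `p`, the Weyl tensor is of (genuine) type N with multiple WAND `l`: in some null frame that
contains `l` its components of boost weight `≥ -1` vanish and one of boost weight `-2` does not. -/
def IsWeylTypeN (g : LorentzMetric d M) (p : M) (l : TangentSpace (𝓡 d) p) : Prop :=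
  ∃ n m, g.IsNullFrame p l n m ∧
    ∀ e ∈ IsManifold.maximalAtlas (𝓡 d) ∞ M, p ∈ e.source → g.WeylBoostOrder e p l n m (-2)

/-- At every point the Weyl tensor is of type III or of type N. -/
def IsWeylTypeIIIOrN (g : LorentzMetric d M) : Prop :=
  ∀ p : M, ∃ l : TangentSpace (𝓡 d) p, g.IsWeylTypeIII p l ∨ g.IsWeylTypeN p l

/-- The Ricci tensor is `R_{ab} = Λ g_{ab} + η k_a k_b` on all of `M`, in every chart. -/
def HasRicciTensor (g : LorentzMetric d M) (Λ : ℝ) (η : M → ℝ)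
    (k : (p : M) → TangentSpace (𝓡 d) p) : Prop :=
  ∀ e ∈ IsManifold.maximalAtlas (𝓡 d) ∞ M, ∀ p ∈ e.source, ∀ u v : TangentSpace (𝓡 d) p,
    g.ric e p u v = Λ * g.inner p u v + η p * g.inner p (k p) u * g.inner p (k p) v

/-- The integral curves of `X` through `V` are geodesics, up to parametrization:
`∇_X X` is proportional to `X` at every point of `V` (as seen in any chart). -/
def IsGeodeticOn (g : LorentzMetric d M) (X : (p : M) → TangentSpace (𝓡 d) p) (V : Set M) : Prop :=
  ∀ p ∈ V, ∀ e ∈ IsManifold.maximalAtlas (𝓡 d) ∞ M, p ∈ e.source →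
    ∃ f : ℝ, ∀ a, g.covDeriv e X p (X p) a = f * coord e p (X p) a

/-- `κ_i = L_{(i)(0)} = 0` on `V`, in every null frame `(ℓ, n, m_i)` at every point of `V`. -/
def KappaVanishesOn (g : LorentzMetric d M) (l : (p : M) → TangentSpace (𝓡 d) p)
    (V : Set M) : Prop :=
  ∀ p ∈ V, ∀ e ∈ IsManifold.maximalAtlas (𝓡 d) ∞ M, p ∈ e.source →
    ∀ n m, g.IsNullFrame p (l p) n m → ∀ i, g.covDerivForm e l p (m i) (l p) = 0

end LorentzMetric

end Spacetime

end

noncomputable section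

namespace Spacetime

section

/-! ### Curvature identities over a commutative algebra with derivations -/

section Algebra

variable {ι A : Type*} [CommRing A] [Algebra ℝ A]

/-! The result follows from the contracted Bianchi identity 2∇_a R^a_f = ∂_f R. Near a point write X
for ℓ, so that R_{ab} = Λ g_{ab} + ψ X_a X_b, where ψ is η divided by the square of the factor
between ℓ and k. Since X is null, the scalar curvature is the constant Λd, hence ∇_a(ψ X^a X_f) = 0.
Expanding, (∇_a(ψX^a)) X_f + ψ X^a ∇_a X_f = 0, and ψ ≠ 0 makes ∇_X X a multiple of X. Pairing with
m_(i), which is orthogonal to ℓ, gives κ_i = 0.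

The expansion needs care because ψ need not be differentiable. The mixed Ricci tensor is
differentiable, however, and some covariant component X_{f₀} is nonzero nearby, so ψX^a is
differentiable as the quotient (R^a_{f₀} - Λ δ^a_{f₀}) / X_{f₀}. This argument is
`IsMetricOn.acceleration_proportional`.

The Bianchi identity is proved as pure algebra in `contracted_bianchi_algebraic`, for matrices over
a commutative ring with commuting derivations. It is then applied to the ring of functions smooth on
a coordinate domain, with partial derivatives as derivations (`IsMetricOn.contracted_bianchi`).
`LorentzMetric.isMetricOn_comp` and `differentiableAt_fieldComp` bring the manifold statement down
to such a domain. -/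

theorem map_derivation_add (δ : Derivation ℝ A A) (M N : Matrix ι ι A) :
    (M + N).map δ = M.map δ + N.map δ := by
  ext; simp

theorem map_derivation_sub (δ : Derivation ℝ A A) (M N : Matrix ι ι A) :
    (M - N).map δ = M.map δ - N.map δ := by
  ext; simp

theorem map_derivation_comm {D : ι → Derivation ℝ A A}
    (hD : ∀ i j x, D i (D j x) = D j (D i x)) (i j : ι)
    (M : Matrix ι ι A) : (M.map (D i)).map (D j) = (M.map (D j)).map (D i) := by
  ext; simp [hD j i]

variable [Fintype ι]

theorem map_derivation_mul (δ : Derivation ℝ A A) (M N : Matrix ι ι A) :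
    (M * N).map δ = M.map δ * N + M * N.map δ := by
  ext i j
  simp only [Matrix.map_apply, Matrix.mul_apply, Matrix.add_apply, map_sum, Derivation.leibniz,
    smul_eq_mul, ← Finset.sum_add_distrib]
  exact Finset.sum_congr rfl fun k _ => by ring

/-- The curvature `R_{ce} = ∂_c Γ_e - ∂_e Γ_c + [Γ_c, Γ_e]` of the connection with matrices
`Γ_c = (Γ^a_{cb})_{ab}`. -/
def curvature (D : ι → Derivation ℝ A A) (Γ : ι → Matrix ι ι A) (c e : ι) : Matrix ι ι A :=
  (Γ e).map (D c) - (Γ c).map (D e) + (Γ c * Γ e - Γ e * Γ c)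

variable {D : ι → Derivation ℝ A A} {Γ : ι → Matrix ι ι A} {G H : Matrix ι ι A}

theorem curvature_swap (c e : ι) : curvature D Γ e c = -curvature D Γ c e := by
  simp only [curvature]; abel

/-- The differential Bianchi identity. -/
theorem curvature_bianchi (hD : ∀ i j x, D i (D j x) = D j (D i x)) (f c e : ι) :
    ((curvature D Γ c e).map (D f) + (Γ f * curvature D Γ c e - curvature D Γ c e * Γ f))
    + ((curvature D Γ e f).map (D c) + (Γ c * curvature D Γ e f - curvature D Γ e f * Γ c))
    + ((curvature D Γ f c).map (D e) + (Γ e * curvature D Γ f c - curvature D Γ f c * Γ e))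
    = 0 := by
  simp only [curvature, map_derivation_add, map_derivation_sub, map_derivation_mul]
  -- Once the second derivatives of Γ are matched, what remains is the Jacobi identity and the
  -- Leibniz terms. No symmetry of Γ is needed.
  rw [map_derivation_comm hD f c, map_derivation_comm hD f e, map_derivation_comm hD c e]
  noncomm_ring

/-- The curvature of a metric connection is skew-symmetric. -/
theorem curvature_metric_skew (hD : ∀ i j x, D i (D j x) = D j (D i x))
    (hG : ∀ c, G.map (D c) = G * Γ c + (Γ c).transpose * G) (c e : ι) :
    G * curvature D Γ c e + (curvature D Γ c e).transpose * G = 0 := by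
  -- The two orders of differentiating G, each expanded by ∇G = 0, differ exactly by the symmetrized
  -- curvature term.
  have h := map_derivation_comm hD c e G
  have ht : ∀ i j, ((Γ i).transpose).map (D j) = ((Γ i).map (D j)).transpose := fun _ _ => rfl
  simp only [hG, map_derivation_add, map_derivation_mul, ht] at h
  rw [← sub_eq_zero] at h
  have h' := congrArg (fun M => -M) h
  simp only [neg_zero] at h'
  rw [← h']
  simp only [curvature, Matrix.transpose_add, Matrix.transpose_sub, Matrix.transpose_mul]
  noncomm_ring

variable [DecidableEq ι]

/-- Differentiating GH = 1 turns ∇G = 0 into ∇H = 0. -/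
theorem map_derivation_inverse (hGH : G * H = 1) (hHG : H * G = 1)
    (hG : ∀ c, G.map (D c) = G * Γ c + (Γ c).transpose * G) (c : ι) :
    H.map (D c) = -(Γ c * H) - H * (Γ c).transpose := by
  have h1 : (1 : Matrix ι ι A).map (D c) = 0 := by
    ext i j; by_cases h : i = j <;> simp [h]
  have h := map_derivation_mul (D c) G H
  rw [hGH, h1, hG] at h
  have h2 : H * (G * H.map (D c)) = -(H * ((G * Γ c + (Γ c).transpose * G) * H)) := by
    rw [← Matrix.mul_neg]; congr 1; exact (neg_eq_of_add_eq_zero_right h.symm).symm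
  rw [← Matrix.mul_assoc, hHG, Matrix.one_mul] at h2
  rw [h2, Matrix.add_mul, Matrix.mul_add, Matrix.mul_assoc G, ← Matrix.mul_assoc H G, hHG,
    Matrix.one_mul, Matrix.mul_assoc _ G H, hGH, Matrix.mul_one]
  abel

/-- Multiplying the skewness of the lowered curvature by H on both sides raises both indices, so
R^{ab}_{ce} is skew in a, b. -/
theorem curvature_mul_inverse_skew (hGH : G * H = 1) (hHG : H * G = 1)
    (hH : H.transpose = H) (hD : ∀ i j x, D i (D j x) = D j (D i x))
    (hG : ∀ c, G.map (D c) = G * Γ c + (Γ c).transpose * G) (c e : ι) :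
    (curvature D Γ c e * H).transpose = -(curvature D Γ c e * H) := by
  have h := curvature_metric_skew hD hG c e
  have h2 : H * (G * curvature D Γ c e + (curvature D Γ c e).transpose * G) * H = 0 := by
    rw [h]; simp
  rw [Matrix.mul_add, Matrix.add_mul, ← Matrix.mul_assoc, hHG, Matrix.one_mul,
    Matrix.mul_assoc, Matrix.mul_assoc, hGH, Matrix.mul_one] at h2
  rw [Matrix.transpose_mul, hH]
  exact (neg_eq_of_add_eq_zero_right h2).symm

/-- Because ∇H = 0, the factor H passes through the covariant derivative; the commutator with Γ
becomes one Γ term for each upper index. -/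
theorem curvature_bianchi_raised (hGH : G * H = 1) (hHG : H * G = 1)
    (hD : ∀ i j x, D i (D j x) = D j (D i x))
    (hG : ∀ c, G.map (D c) = G * Γ c + (Γ c).transpose * G) (f c e : ι) :
    ((curvature D Γ c e * H).map (D f) + Γ f * (curvature D Γ c e * H)
      + curvature D Γ c e * H * (Γ f).transpose)
    + ((curvature D Γ e f * H).map (D c) + Γ c * (curvature D Γ e f * H)
      + curvature D Γ e f * H * (Γ c).transpose)
    + ((curvature D Γ f c * H).map (D e) + Γ e * (curvature D Γ f c * H)
      + curvature D Γ f c * H * (Γ e).transpose) = 0 := by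
  have h := congrArg (· * H) (curvature_bianchi (Γ := Γ) hD f c e)
  simp only [Matrix.zero_mul] at h
  rw [← h]
  simp only [map_derivation_mul, map_derivation_inverse hGH hHG hG]
  noncomm_ring

/-- The contracted Bianchi identity `2 ∇_a P^a_f = ∂_f P^a_a` for the mixed Ricci tensor
`P^a_f`. -/
theorem contracted_bianchi_algebraic (hGH : G * H = 1) (hHG : H * G = 1)
    (hH : H.transpose = H) (hD : ∀ i j x, D i (D j x) = D j (D i x))
    (hΓ : ∀ a b c, Γ b a c = Γ c a b)
    (hG : ∀ c, G.map (D c) = G * Γ c + (Γ c).transpose * G) (P : Matrix ι ι A)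
    (hP : ∀ b f, P b f = ∑ a, (curvature D Γ a f * H) a b) (f : ι) :
    2 * (∑ a, D a (P a f) + ∑ a, ∑ s, Γ a a s * P s f - ∑ a, ∑ s, Γ f a s * P s a)
      = D f (∑ a, P a a) := by
  -- `W c e a b` is R^{ab}_{ce}. Skewness in each pair is enough below; the pair-exchange symmetry
  -- is not needed.
  set W : ι → ι → Matrix ι ι A := fun c e => curvature D Γ c e * H with hW
  have hPW : ∀ b f, P b f = ∑ a, W a f a b := hP
  have skew1 : ∀ c e a b, W c e b a = -W c e a b := fun c e a b => by
    have := congrFun (congrFun (curvature_mul_inverse_skew hGH hHG hH hD hG c e) a) b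
    simpa using this
  have skew2 : ∀ c e a b, W e c a b = -W c e a b := fun c e a b => by
    simp only [hW, curvature_swap c e, Matrix.neg_mul, Matrix.neg_apply]
  have bian : ∀ f c e a b,
      (D f (W c e a b) + ∑ s, Γ f a s * W c e s b + ∑ s, W c e a s * Γ f b s)
      + (D c (W e f a b) + ∑ s, Γ c a s * W e f s b + ∑ s, W e f a s * Γ c b s)
      + (D e (W f c a b) + ∑ s, Γ e a s * W f c s b + ∑ s, W f c a s * Γ e b s) = 0 := by
    intro f c e a b
    have h := congrFun (congrFun (curvature_bianchi_raised hGH hHG hD hG f c e) a) b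
    change ((W c e).map (D f) + Γ f * W c e + W c e * (Γ f).transpose
      + ((W e f).map (D c) + Γ c * W e f + W e f * (Γ c).transpose)
      + ((W f c).map (D e) + Γ e * W f c + W f c * (Γ e).transpose)) a b = 0 at h
    simpa only [Matrix.add_apply, Matrix.map_apply, Matrix.mul_apply, Matrix.transpose_apply]
      using h
  -- The double trace of the Bianchi identity: the form indices c, e are contracted with the upper
  -- indices a, b. The cyclic term in f yields the trace of P, the other two yield its divergence.
  have hsum : ∑ a, ∑ b, ((D f (W a b a b) + ∑ s, Γ f a s * W a b s b + ∑ s, W a b a s * Γ f b s)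
      + (D a (W b f a b) + ∑ s, Γ a a s * W b f s b + ∑ s, W b f a s * Γ a b s)
      + (D b (W f a a b) + ∑ s, Γ b a s * W f a s b + ∑ s, W f a a s * Γ b b s)) = 0 :=
    Finset.sum_eq_zero fun a _ => Finset.sum_eq_zero fun b _ => bian f a b a b
  simp only [Finset.sum_add_distrib] at hsum
  have e1 : ∑ a, ∑ b, D f (W a b a b) = D f (∑ a, P a a) := by
    rw [Finset.sum_comm]; simp only [hPW, map_sum]
  have e2 : ∑ a, ∑ b, ∑ s, Γ f a s * W a b s b = ∑ a, ∑ s, Γ f a s * P s a := by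
    refine Finset.sum_congr rfl fun a _ => ?_
    rw [Finset.sum_comm]
    refine Finset.sum_congr rfl fun s _ => ?_
    rw [hPW, Finset.mul_sum]
    refine Finset.sum_congr rfl fun b _ => ?_
    rw [skew1, skew2]; ring
  have e3 : ∑ a, ∑ b, ∑ s, W a b a s * Γ f b s = ∑ a, ∑ s, Γ f a s * P s a := by
    rw [Finset.sum_comm]
    refine Finset.sum_congr rfl fun a _ => ?_
    rw [Finset.sum_comm]
    refine Finset.sum_congr rfl fun s _ => ?_
    rw [hPW, Finset.mul_sum]
    exact Finset.sum_congr rfl fun b _ => mul_comm _ _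
  have e4 : ∑ a, ∑ b, D a (W b f a b) = -∑ a, D a (P a f) := by
    simp only [hPW, map_sum, ← Finset.sum_neg_distrib]
    refine Finset.sum_congr rfl fun a _ => Finset.sum_congr rfl fun b _ => ?_
    rw [skew1, map_neg]
  have e5 : ∑ a, ∑ b, ∑ s, Γ a a s * W b f s b = -∑ a, ∑ s, Γ a a s * P s f := by
    rw [← Finset.sum_neg_distrib]
    refine Finset.sum_congr rfl fun a _ => ?_
    rw [Finset.sum_comm, ← Finset.sum_neg_distrib]
    refine Finset.sum_congr rfl fun s _ => ?_
    rw [hPW, Finset.mul_sum, ← Finset.sum_neg_distrib]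
    refine Finset.sum_congr rfl fun b _ => ?_
    rw [skew1]; ring
  -- Here Γ^b_{as}, symmetric in a and s by absence of torsion, meets a W that is skew in them.
  have e6 : ∑ a, ∑ b, ∑ s, W b f a s * Γ a b s + ∑ a, ∑ b, ∑ s, Γ b a s * W f a s b = 0 := by
    have h : ∀ b, ∑ a, ∑ s, W b f a s * Γ a b s = -∑ a, ∑ s, W b f a s * Γ a b s := by
      intro b
      nth_rewrite 1 [Finset.sum_comm]
      simp only [← Finset.sum_neg_distrib]
      refine Finset.sum_congr rfl fun a _ => Finset.sum_congr rfl fun s _ => ?_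
      rw [skew1, hΓ b s a]; ring
    rw [← eq_neg_iff_add_eq_zero, Finset.sum_comm, ← Finset.sum_neg_distrib]
    refine Finset.sum_congr rfl fun b _ => ?_
    rw [h b]
    congr 1
    refine Finset.sum_congr rfl fun a _ => Finset.sum_congr rfl fun s _ => ?_
    rw [skew2 b f, skew1 b f a s]
    ring
  have e7 : ∑ a, ∑ b, D b (W f a a b) = -∑ a, D a (P a f) := by
    rw [Finset.sum_comm]
    simp only [hPW, map_sum, ← Finset.sum_neg_distrib]
    refine Finset.sum_congr rfl fun a _ => Finset.sum_congr rfl fun b _ => ?_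
    rw [skew2, map_neg]
  have e8 : ∑ a, ∑ b, ∑ s, W f a a s * Γ b b s = -∑ a, ∑ s, Γ a a s * P s f := by
    rw [Finset.sum_comm, ← Finset.sum_neg_distrib]
    refine Finset.sum_congr rfl fun a _ => ?_
    rw [Finset.sum_comm, ← Finset.sum_neg_distrib]
    refine Finset.sum_congr rfl fun s _ => ?_
    rw [hPW, Finset.mul_sum, ← Finset.sum_neg_distrib]
    refine Finset.sum_congr rfl fun b _ => ?_
    rw [skew2]; ring
  rw [e1, e2, e3, e4, e5, e7, e8] at hsum
  linear_combination e6 - hsum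

end Algebra

end

section

/-! ### The Levi-Civita connection of a symmetric invertible matrix -/

section LeviCivita

variable {ι A : Type*} [Fintype ι] [CommRing A] [Algebra ℝ A]

/-- The connection matrices `Γ_c = (Γ^a_{cb})_{ab}` of the metric `G` with inverse `H`. -/
def leviCivita (D : ι → Derivation ℝ A A) (G H : Matrix ι ι A) (c : ι) : Matrix ι ι A :=
  Matrix.of fun a b =>
    (1 / 2 : ℝ) • ∑ s, H a s * (D c (G s b) + D b (G s c) - D s (G c b))

variable {D : ι → Derivation ℝ A A} {G H : Matrix ι ι A}

theorem leviCivita_symm (hG : G.transpose = G) (a b c : ι) :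
    leviCivita D G H b a c = leviCivita D G H c a b := by
  have hs : ∀ a b, G a b = G b a := fun a b => congrFun (congrFun hG b) a
  simp only [leviCivita, Matrix.of_apply]
  congr 1
  refine Finset.sum_congr rfl fun s _ => ?_
  rw [hs b c]; ring

variable [DecidableEq ι]

/-- Multiplication by G cancels H and leaves the Christoffel symbols of the first kind. In the sum
with the transpose, the two derivatives in directions other than c cancel. -/
theorem leviCivita_metric (hGH : G * H = 1) (hG : G.transpose = G) (c : ι) :
    G.map (D c) = G * leviCivita D G H c + (leviCivita D G H c).transpose * G := by
  have hs : ∀ a b, G a b = G b a := fun a b => congrFun (congrFun hG b) a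
  have key : ∀ r b, (G * leviCivita D G H c) r b =
      (1 / 2 : ℝ) • (D c (G r b) + D b (G r c) - D r (G c b)) := by
    intro r b
    have h : leviCivita D G H c = (1 / 2 : ℝ) •
        (H * Matrix.of fun s b => D c (G s b) + D b (G s c) - D s (G c b)) := by
      ext a b; simp [leviCivita, Matrix.mul_apply]
    rw [h, Matrix.mul_smul, ← Matrix.mul_assoc, hGH, Matrix.one_mul]
    rfl
  have ht : (leviCivita D G H c).transpose * G = (G * leviCivita D G H c).transpose := by
    rw [Matrix.transpose_mul, hG]
  ext r b
  rw [ht, Matrix.add_apply, Matrix.transpose_apply, key, key, Matrix.map_apply, ← smul_add,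
    hs b r, hs b c, hs r c]
  have : D c (G r b) + D b (G c r) - D r (G c b) + (D c (G r b) + D r (G c b) - D b (G c r))
      = (2 : ℝ) • D c (G r b) := by
    rw [two_smul]; ring
  rw [this, smul_smul]; norm_num

end LeviCivita

/-! ### The ring of functions smooth on an open set, and metrics over it -/

variable {d : ℕ}

/-- The real functions that are smooth on `U`. -/
def smoothOn (U : Set (EuclideanSpace ℝ (Fin d))) :
    Subalgebra ℝ (EuclideanSpace ℝ (Fin d) → ℝ) where
  carrier := {f | ContDiffOn ℝ ∞ f U}
  mul_mem' hf hg := ContDiffOn.mul hf hg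
  add_mem' hf hg := ContDiffOn.add hf hg
  algebraMap_mem' _ := contDiffOn_const

variable {U : Set (EuclideanSpace ℝ (Fin d))}

theorem differentiableAt_of_mem_smoothOn (hU : IsOpen U) (f : smoothOn U)
    {y : EuclideanSpace ℝ (Fin d)} (hy : y ∈ U) : DifferentiableAt ℝ f.1 y :=
  (ContDiffOn.contDiffAt f.2 (hU.mem_nhds hy)).differentiableAt (by simp)

theorem contDiffOn_pd (hU : IsOpen U) (i : Fin d) {f : EuclideanSpace ℝ (Fin d) → ℝ}
    (hf : ContDiffOn ℝ ∞ f U) : ContDiffOn ℝ ∞ (pd i f) U :=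
  (hf.fderiv_of_isOpen hU (by simp)).clm_apply contDiffOn_const

theorem pd_congr_of_eqOn (hU : IsOpen U) {f h : EuclideanSpace ℝ (Fin d) → ℝ}
    (hfh : Set.EqOn f h U) {y : EuclideanSpace ℝ (Fin d)} (hy : y ∈ U) (i : Fin d) :
    pd i f y = pd i h y := by
  simp only [pd]
  rw [(hfh.eventuallyEq_of_mem (hU.mem_nhds hy)).fderiv_eq]

theorem pd_comm (hU : IsOpen U) {f : EuclideanSpace ℝ (Fin d) → ℝ} (hf : ContDiffOn ℝ ∞ f U)
    {y : EuclideanSpace ℝ (Fin d)} (hy : y ∈ U) (i j : Fin d) :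
    pd i (pd j f) y = pd j (pd i f) y := by
  have hf' := hf.contDiffAt (hU.mem_nhds hy)
  have hd : DifferentiableAt ℝ (fderiv ℝ f) y :=
    ((hf.fderiv_of_isOpen hU (m := ∞) (by simp)).contDiffAt (hU.mem_nhds hy)).differentiableAt
      (by simp)
  have hs : IsSymmSndFDerivAt ℝ f y := hf'.isSymmSndFDerivAt (by
    rw [minSmoothness_of_isRCLikeNormedField]; exact WithTop.coe_le_coe.2 le_top)
  have h : ∀ v w, fderiv ℝ (fun z => fderiv ℝ f z v) y w = fderiv ℝ (fderiv ℝ f) y w v := by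
    intro v w
    rw [fderiv_clm_apply hd (differentiableAt_const v)]
    simp
  change fderiv ℝ (fun z => fderiv ℝ f z _) y _ = fderiv ℝ (fun z => fderiv ℝ f z _) y _
  rw [h, h]
  exact hs _ _

/-- The partial derivative as a derivation of the smooth functions on `U`, extended by zero
outside `U`. -/
def pdDerivation (hU : IsOpen U) (i : Fin d) : Derivation ℝ (smoothOn U) (smoothOn U) :=
  Derivation.mk'
    -- Elements of the algebra are functions on the whole space, compared everywhere, though they
    -- may be non-differentiable off U. Cutting off by zero keeps additivity and the Leibniz rule
    -- valid there.
    { toFun := fun f => ⟨U.indicator (pd i f.1),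
        (contDiffOn_pd hU i f.2).congr fun _ hy => Set.indicator_of_mem hy _⟩
      map_add' := fun f h => by
        ext y
        by_cases hy : y ∈ U
        · have hf := differentiableAt_of_mem_smoothOn hU f hy
          have hh := differentiableAt_of_mem_smoothOn hU h hy
          simp [hy, pd, fderiv_add hf hh]
        · simp [hy]
      map_smul' := fun c f => by
        ext y
        by_cases hy : y ∈ U
        · have hf := differentiableAt_of_mem_smoothOn hU f hy
          simp [hy, pd, fderiv_const_smul hf]
        · simp [hy] }
    (fun f h => by
      ext y
      by_cases hy : y ∈ U
      · have hf := differentiableAt_of_mem_smoothOn hU f hy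
        have hh := differentiableAt_of_mem_smoothOn hU h hy
        simp [hy, pd, fderiv_mul hf hh]
      · simp [hy])

theorem pdDerivation_apply (hU : IsOpen U) (i : Fin d) (f : smoothOn U)
    {y : EuclideanSpace ℝ (Fin d)} (hy : y ∈ U) : (pdDerivation hU i f).1 y = pd i f.1 y :=
  Set.indicator_of_mem hy _

theorem pdDerivation_apply_of_notMem (hU : IsOpen U) (i : Fin d) (f : smoothOn U)
    {y : EuclideanSpace ℝ (Fin d)} (hy : y ∉ U) : (pdDerivation hU i f).1 y = 0 :=
  Set.indicator_of_notMem hy _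

theorem pdDerivation_comm (hU : IsOpen U) (i j : Fin d) (f : smoothOn U) :
    pdDerivation hU i (pdDerivation hU j f) = pdDerivation hU j (pdDerivation hU i f) := by
  ext y
  by_cases hy : y ∈ U
  · rw [pdDerivation_apply hU _ _ hy, pdDerivation_apply hU _ _ hy,
      pd_congr_of_eqOn hU (fun z hz => pdDerivation_apply hU j f hz) hy,
      pd_congr_of_eqOn hU (fun z hz => pdDerivation_apply hU i f hz) hy]
    exact pd_comm hU f.2 hy i j
  · rw [pdDerivation_apply_of_notMem hU _ _ hy, pdDerivation_apply_of_notMem hU _ _ hy]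

/-- The components of a metric on the open set `U`: smooth, symmetric and non-degenerate. -/
structure IsMetricOn (U : Set (EuclideanSpace ℝ (Fin d)))
    (G : EuclideanSpace ℝ (Fin d) → Matrix (Fin d) (Fin d) ℝ) : Prop where
  isOpen : IsOpen U
  smooth : ∀ a b, ContDiffOn ℝ ∞ (fun z => G z a b) U
  symm : ∀ z ∈ U, (G z).transpose = G z
  det_ne_zero : ∀ z ∈ U, (G z).det ≠ 0

namespace IsMetricOn

variable {G : EuclideanSpace ℝ (Fin d) → Matrix (Fin d) (Fin d) ℝ} (h : IsMetricOn U G)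
include h

theorem inv_mul {y : EuclideanSpace ℝ (Fin d)} (hy : y ∈ U) : (G y)⁻¹ * G y = 1 :=
  Matrix.nonsing_inv_mul _ (isUnit_iff_ne_zero.2 (h.det_ne_zero y hy))

open Classical in
/-- A metric on `U`, continued by the identity outside `U`, is an invertible symmetric matrix of
functions that are smooth on `U`. -/
theorem exists_lift : ∃ A B : Matrix (Fin d) (Fin d) (smoothOn U),
    A * B = 1 ∧ B * A = 1 ∧ A.transpose = A ∧ B.transpose = B ∧
    ∀ y ∈ U, ∀ a b, (A a b).1 y = G y a b ∧ (B a b).1 y = (G y)⁻¹ a b := by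
  let ev : EuclideanSpace ℝ (Fin d) → smoothOn U →+* ℝ := fun y =>
    (Pi.evalRingHom (fun _ : EuclideanSpace ℝ (Fin d) => ℝ) y).comp (smoothOn U).val.toRingHom
  -- The value 1 off U keeps the determinant nonzero at every point, which makes it a unit of the
  -- algebra.
  let A : Matrix (Fin d) (Fin d) (smoothOn U) := Matrix.of fun a b =>
    ⟨fun z => if z ∈ U then G z a b else (1 : Matrix (Fin d) (Fin d) ℝ) a b,
      (h.smooth a b).congr fun z hz => by simp [hz]⟩
  have hA : ∀ y, A.map (ev y) = if y ∈ U then G y else 1 := by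
    intro y
    ext a b
    by_cases hy : y ∈ U <;> simp [A, ev, hy]
  have hdet : ∀ y, A.det.1 y ≠ 0 := by
    intro y
    have h1 : A.det.1 y = (A.map (ev y)).det := RingHom.map_det (ev y) A
    rw [h1, hA]
    by_cases hy : y ∈ U
    · simpa [hy] using h.det_ne_zero y hy
    · simp [hy]
  have hunit : IsUnit A.det := by
    refine IsUnit.of_mul_eq_one (⟨fun z => (A.det.1 z)⁻¹, ContDiffOn.inv A.det.2 fun z _ => hdet z⟩)
      ?_
    ext z
    exact mul_inv_cancel₀ (hdet z)
  have hAt : A.transpose = A := by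
    ext a b z
    by_cases hz : z ∈ U
    · simpa [A, hz] using congrFun (congrFun (h.symm z hz) a) b
    · simp [A, hz, Matrix.one_apply, eq_comm]
  refine ⟨A, A⁻¹, Matrix.mul_nonsing_inv A hunit, Matrix.nonsing_inv_mul A hunit, hAt, ?_, ?_⟩
  · rw [Matrix.transpose_nonsing_inv, hAt]
  · intro y hy a b
    have hAy : A.map (ev y) = G y := by rw [hA, if_pos hy]
    refine ⟨congrFun (congrFun hAy a) b, ?_⟩
    have h1 : (A * A⁻¹).map (ev y) = 1 := by
      rw [Matrix.mul_nonsing_inv A hunit]; simp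
    rw [Matrix.map_mul, hAy] at h1
    rw [Matrix.inv_eq_right_inv h1]
    rfl

end IsMetricOn

/-- The mixed components `R^b_f` of the Ricci tensor. -/
def mixedRicci (G : EuclideanSpace ℝ (Fin d) → Matrix (Fin d) (Fin d) ℝ) (b f : Fin d)
    (y : EuclideanSpace ℝ (Fin d)) : ℝ :=
  ∑ s, (G y)⁻¹ b s * ricci G s f y

/-! ### Coordinate Christoffel, Riemann and Ricci components as elements of the ring -/

section Lift

variable {G : EuclideanSpace ℝ (Fin d) → Matrix (Fin d) (Fin d) ℝ} (hU : IsOpen U)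
  {A B : Matrix (Fin d) (Fin d) (smoothOn U)}
  (hA : ∀ y ∈ U, ∀ a b, (A a b).1 y = G y a b ∧ (B a b).1 y = (G y)⁻¹ a b)
include hA

theorem christoffel_eq_leviCivita {y : EuclideanSpace ℝ (Fin d)} (hy : y ∈ U) (a b c : Fin d) :
    christoffel G a b c y = (leviCivita (pdDerivation hU) A B b a c).1 y := by
  have hpd : ∀ i s t, pd i (fun z => G z s t) y = (pdDerivation hU i (A s t)).1 y := by
    intro i s t
    rw [pdDerivation_apply hU _ _ hy]
    exact pd_congr_of_eqOn hU (fun z hz => (hA z hz s t).1.symm) hy i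
  simp [christoffel, leviCivita, hpd, (hA y hy _ _).2]

theorem riemann_eq_curvature {y : EuclideanSpace ℝ (Fin d)} (hy : y ∈ U) (a b c e : Fin d) :
    riemann G a b c e y
      = (curvature (pdDerivation hU) (leviCivita (pdDerivation hU) A B) c e a b).1 y := by
  have hpd : ∀ i a b c, pd i (christoffel G a b c) y
      = (pdDerivation hU i (leviCivita (pdDerivation hU) A B b a c)).1 y := by
    intro i a b c
    rw [pdDerivation_apply hU _ _ hy]
    exact pd_congr_of_eqOn hU (fun z hz => christoffel_eq_leviCivita hU hA hz a b c) hy i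
  simp [riemann, curvature, hpd, christoffel_eq_leviCivita hU hA hy, Matrix.mul_apply,
    Finset.sum_sub_distrib]

theorem mixedRicci_eq_sum_curvature (hB : B.transpose = B) {y : EuclideanSpace ℝ (Fin d)}
    (hy : y ∈ U) (b f : Fin d) :
    mixedRicci G b f y = (∑ a, (curvature (pdDerivation hU)
      (leviCivita (pdDerivation hU) A B) a f * B) a b : smoothOn U).1 y := by
  have hs : ∀ s, (G y)⁻¹ b s = (B s b).1 y := fun s => by
    rw [← (hA y hy b s).2]; exact congrArg (fun x => x.1 y) (congrFun (congrFun hB s) b)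
  simp only [mixedRicci, ricci, Matrix.mul_apply, riemann_eq_curvature hU hA hy, hs,
    Finset.mul_sum]
  rw [Finset.sum_comm]
  simp [mul_comm]

end Lift

namespace IsMetricOn

variable {G : EuclideanSpace ℝ (Fin d) → Matrix (Fin d) (Fin d) ℝ} (h : IsMetricOn U G)
  {y : EuclideanSpace ℝ (Fin d)} (hy : y ∈ U)
include h hy

theorem christoffel_symm (a b c : Fin d) : christoffel G a b c y = christoffel G a c b y := by
  obtain ⟨A, B, -, -, hAt, -, hAB⟩ := h.exists_lift
  rw [christoffel_eq_leviCivita h.isOpen hAB hy, christoffel_eq_leviCivita h.isOpen hAB hy,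
    leviCivita_symm hAt]

theorem pd_eq_christoffel (c a b : Fin d) :
    pd c (fun z => G z a b) y
      = ∑ s, G y a s * christoffel G s c b y + ∑ s, christoffel G s c a y * G y s b := by
  obtain ⟨A, B, hAB1, -, hAt, -, hAB⟩ := h.exists_lift
  have hm := congrFun (congrFun (leviCivita_metric (D := pdDerivation h.isOpen) hAB1 hAt c) a) b
  have hm' := congrArg (fun x => x.1 y) hm
  simp only [Matrix.map_apply, pdDerivation_apply h.isOpen _ _ hy] at hm'
  rw [pd_congr_of_eqOn h.isOpen (fun z hz => (hAB z hz a b).1.symm) hy, hm']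
  simp [Matrix.mul_apply, christoffel_eq_leviCivita h.isOpen hAB hy, (hAB y hy _ _).1]

/-- The source of regularity for ψX^a, since ψ itself has none. -/
theorem differentiableAt_mixedRicci (b f : Fin d) : DifferentiableAt ℝ (mixedRicci G b f) y := by
  obtain ⟨A, B, -, -, -, hBt, hAB⟩ := h.exists_lift
  have heq : Set.EqOn (mixedRicci G b f) _ U := fun z hz =>
    mixedRicci_eq_sum_curvature h.isOpen hAB hBt hz b f
  exact (differentiableAt_of_mem_smoothOn h.isOpen _ hy).congr_of_eventuallyEq
    (heq.eventuallyEq_of_mem (h.isOpen.mem_nhds hy))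

/-- The contracted Bianchi identity `2 ∇_a R^a_f = ∂_f R`. -/
theorem contracted_bianchi (f : Fin d) :
    2 * (∑ a, pd a (mixedRicci G a f) y
      + ∑ a, ∑ s, christoffel G a a s y * mixedRicci G s f y
      - ∑ a, ∑ s, christoffel G a f s y * mixedRicci G s a y)
      = pd f (fun z => ∑ a, mixedRicci G a a z) y := by
  obtain ⟨A, B, hAB1, hAB2, hAt, hBt, hAB⟩ := h.exists_lift
  let D := pdDerivation h.isOpen
  let P : Matrix (Fin d) (Fin d) (smoothOn U) := Matrix.of fun b f =>
    ∑ a, (curvature D (leviCivita D A B) a f * B) a b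
  have hP : ∀ z ∈ U, ∀ b f, mixedRicci G b f z = (P b f).1 z := fun z hz b f =>
    mixedRicci_eq_sum_curvature h.isOpen hAB hBt hz b f
  have key := congrArg (fun x => x.1 y) (contracted_bianchi_algebraic hAB1 hAB2 hBt
    (pdDerivation_comm h.isOpen) (leviCivita_symm hAt) (leviCivita_metric hAB1 hAt) P
    (fun _ _ => rfl) f)
  have h1 : ∀ a, pd a (mixedRicci G a f) y = (D a (P a f)).1 y := fun a => by
    rw [pdDerivation_apply h.isOpen _ _ hy]
    exact pd_congr_of_eqOn h.isOpen (fun z hz => hP z hz a f) hy a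
  have h2 : pd f (fun z => ∑ a, mixedRicci G a a z) y = (D f (∑ a, P a a)).1 y := by
    rw [pdDerivation_apply h.isOpen _ _ hy]
    refine pd_congr_of_eqOn h.isOpen (fun z hz => ?_) hy f
    simp [hP z hz]
  rw [h2, ← key]
  simp [h1, hP y hy, christoffel_eq_leviCivita h.isOpen hAB hy, D]
  exact Or.inl rfl

end IsMetricOn

end

/-! ### Null fields along the Ricci direction, in coordinates -/

section

variable {d : ℕ} {U : Set (EuclideanSpace ℝ (Fin d))}

theorem pd_mul {f h : EuclideanSpace ℝ (Fin d) → ℝ} {y : EuclideanSpace ℝ (Fin d)}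
    (hf : DifferentiableAt ℝ f y) (hh : DifferentiableAt ℝ h y) (i : Fin d) :
    pd i (fun z => f z * h z) y = pd i f y * h y + f y * pd i h y := by
  simp only [pd, fderiv_fun_mul hf hh]
  simp; ring

theorem pd_sum {κ : Type*} [Fintype κ] {f : κ → EuclideanSpace ℝ (Fin d) → ℝ}
    {y : EuclideanSpace ℝ (Fin d)} (hf : ∀ j, DifferentiableAt ℝ (f j) y) (i : Fin d) :
    pd i (fun z => ∑ j, f j z) y = ∑ j, pd i (f j) y := by
  simp only [pd, fderiv_fun_sum fun j _ => hf j]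
  simp

namespace IsMetricOn

variable {G : EuclideanSpace ℝ (Fin d) → Matrix (Fin d) (Fin d) ℝ} (h : IsMetricOn U G)
  {y : EuclideanSpace ℝ (Fin d)} (hy : y ∈ U)
include h hy

theorem differentiableAt (a b : Fin d) : DifferentiableAt ℝ (fun z => G z a b) y :=
  ((h.smooth a b).contDiffAt (h.isOpen.mem_nhds hy)).differentiableAt (by simp)

theorem eq_of_mulVec_eq {v w : Fin d → ℝ} (hvw : (G y).mulVec v = (G y).mulVec w) : v = w := by
  have := congrArg (G y)⁻¹.mulVec hvw
  simpa [Matrix.mulVec_mulVec, h.inv_mul hy] using this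

/-- Lowering the index of `∇_X X`. -/
theorem sum_lower_acceleration {X : Fin d → EuclideanSpace ℝ (Fin d) → ℝ}
    (hX : ∀ a, DifferentiableAt ℝ (X a) y) (f : Fin d) :
    ∑ a, X a y * pd a (fun z => ∑ s, G z f s * X s z) y
      - ∑ a, ∑ s, christoffel G a f s y * (X s y * ∑ t, G y a t * X t y)
      = ∑ b, G y f b * (∑ c, X c y * pd c (X b) y
          + ∑ c, ∑ e, christoffel G b c e y * X c y * X e y) := by
  have h1 : ∀ a, pd a (fun z => ∑ s, G z f s * X s z) y = ∑ s, ((∑ t, G y f t *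
      christoffel G t a s y + ∑ t, christoffel G t a f y * G y t s) * X s y
      + G y f s * pd a (X s) y) := by
    intro a
    rw [pd_sum fun s => (h.differentiableAt hy f s).fun_mul (hX s)]
    refine Finset.sum_congr rfl fun s _ => ?_
    rw [pd_mul (h.differentiableAt hy f s) (hX s), h.pd_eq_christoffel hy]
  simp only [h1, add_mul, Finset.sum_add_distrib, mul_add, Finset.mul_sum, Finset.sum_mul]
  have e1 : ∑ a, ∑ s, ∑ t, X a y * (christoffel G t a f y * G y t s * X s y)
      = ∑ a, ∑ s, ∑ t, christoffel G a f s y * (X s y * (G y a t * X t y)) := by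
    have : ∀ a, ∑ s, ∑ t, X a y * (christoffel G t a f y * G y t s * X s y)
        = ∑ t, ∑ s, christoffel G t f a y * (X a y * (G y t s * X s y)) := fun a => by
      rw [Finset.sum_comm]
      refine Finset.sum_congr rfl fun t _ => Finset.sum_congr rfl fun s _ => ?_
      rw [h.christoffel_symm hy t a f]; ring
    simp only [this]
    rw [Finset.sum_comm]
  have e2 : ∑ a, ∑ s, ∑ t, X a y * (G y f t * christoffel G t a s y * X s y)
      = ∑ b, ∑ c, ∑ e, G y f b * (christoffel G b c e y * X c y * X e y) := by
    have : ∀ a, ∑ s, ∑ t, X a y * (G y f t * christoffel G t a s y * X s y)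
        = ∑ t, ∑ s, G y f t * (christoffel G t a s y * X a y * X s y) := fun a => by
      rw [Finset.sum_comm]
      exact Finset.sum_congr rfl fun t _ => Finset.sum_congr rfl fun s _ => by ring
    simp only [this]
    rw [Finset.sum_comm]
  have e3 : ∑ a, ∑ s, X a y * (G y f s * pd a (X s) y)
      = ∑ b, ∑ c, G y f b * (X c y * pd c (X b) y) := by
    rw [Finset.sum_comm]
    exact Finset.sum_congr rfl fun t _ => Finset.sum_congr rfl fun s _ => by ring
  rw [e1, e2, e3]; ring

/-- A null vector field `X` with `R_{ab} = Λ g_{ab} + ψ X_a X_b`, `ψ ≠ 0`, is geodetic. -/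
theorem acceleration_proportional {X : Fin d → EuclideanSpace ℝ (Fin d) → ℝ}
    (hX : ∀ a, DifferentiableAt ℝ (X a) y) (hX0 : ∃ a, X a y ≠ 0)
    {Λ : ℝ} {ψ : EuclideanSpace ℝ (Fin d) → ℝ} (hψ : ψ y ≠ 0)
    (hnull : ∀ z ∈ U, ∑ a, X a z * ∑ s, G z a s * X s z = 0)
    (hRic : ∀ z ∈ U, ∀ a b, ricci G a b z = Λ * G z a b
      + ψ z * (∑ s, G z a s * X s z) * ∑ s, G z b s * X s z) :
    ∃ φ : ℝ, ∀ a, ∑ b, X b y * pd b (X a) y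
      + ∑ b, ∑ c, christoffel G a b c y * X b y * X c y = φ * X a y := by
  set L : Fin d → EuclideanSpace ℝ (Fin d) → ℝ := fun f z => ∑ s, G z f s * X s z with hL
  have hLd : ∀ f, DifferentiableAt ℝ (L f) y := fun f =>
    DifferentiableAt.fun_sum fun s _ => (h.differentiableAt hy f s).mul (hX s)
  have hP : ∀ z ∈ U, ∀ b f, mixedRicci G b f z
      = Λ * (1 : Matrix (Fin d) (Fin d) ℝ) b f + ψ z * (X b z * L f z) := by
    intro z hz b f
    have hXL : ∑ s, (G z)⁻¹ b s * L s z = X b z := by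
      have : ((G z)⁻¹.mulVec ((G z).mulVec fun s => X s z)) b = X b z := by
        rw [Matrix.mulVec_mulVec, h.inv_mul hz, Matrix.one_mulVec]
      exact this
    rw [mixedRicci, ← h.inv_mul hz, Matrix.mul_apply, ← hXL, Finset.sum_mul, Finset.mul_sum,
      Finset.mul_sum, ← Finset.sum_add_distrib]
    refine Finset.sum_congr rfl fun s _ => ?_
    rw [hRic z hz]; ring
  have htrace : ∀ z ∈ U, ∑ a, mixedRicci G a a z = Λ * d := by
    intro z hz
    simp only [hP z hz, Finset.sum_add_distrib, ← Finset.mul_sum, hL, hnull z hz]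
    simp
  have hdiv : ∀ f, ∑ a, pd a (mixedRicci G a f) y
      + ∑ a, ∑ s, christoffel G a a s y * mixedRicci G s f y
      - ∑ a, ∑ s, christoffel G a f s y * mixedRicci G s a y = 0 := by
    intro f
    have hb := h.contracted_bianchi hy f
    have h0 : pd f (fun z => ∑ a, mixedRicci G a a z) y = 0 := by
      rw [pd_congr_of_eqOn h.isOpen htrace hy]
      simp [pd]
    rw [h0] at hb
    exact (mul_eq_zero.1 hb).resolve_left two_ne_zero
  -- Nondegeneracy of the metric: lowering the index of a nonzero vector cannot give zero.
  obtain ⟨f₀, hf₀⟩ : ∃ f, L f y ≠ 0 := by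
    by_contra! hall
    obtain ⟨a, ha⟩ := hX0
    have : (fun s => X s y) = 0 := h.eq_of_mulVec_eq hy (by
      rw [Matrix.mulVec_zero]; exact funext hall)
    exact ha (congrFun this a)
  -- A differentiable stand-in for ψX^a, equal to it wherever X_{f₀} ≠ 0, hence on a neighbourhood
  -- of y.
  set q : Fin d → EuclideanSpace ℝ (Fin d) → ℝ := fun a z =>
    (mixedRicci G a f₀ z - Λ * (1 : Matrix (Fin d) (Fin d) ℝ) a f₀) / L f₀ z with hq
  have hqd : ∀ a, DifferentiableAt ℝ (q a) y := fun a => by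
    simp only [hq, div_eq_mul_inv]
    exact ((h.differentiableAt_mixedRicci hy a f₀).sub_const _).fun_mul ((hLd f₀).fun_inv hf₀)
  have hqX : ∀ a, ∀ z ∈ U, L f₀ z ≠ 0 → q a z = ψ z * X a z := by
    intro a z hz hne
    simp only [hq, hP z hz]
    field_simp; ring
  have hpd : ∀ a f, pd a (mixedRicci G a f) y
      = pd a (q a) y * L f y + ψ y * X a y * pd a (L f) y := by
    intro a f
    have hev : mixedRicci G a f =ᶠ[nhds y]
        fun z => Λ * (1 : Matrix (Fin d) (Fin d) ℝ) a f + q a z * L f z := by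
      filter_upwards [h.isOpen.mem_nhds hy, (hLd f₀).continuousAt.eventually_ne hf₀] with z hz hne
      rw [hP z hz, hqX a z hz hne]; ring
    have : pd a (mixedRicci G a f) y = pd a (fun z => q a z * L f z) y := by
      simp only [pd]; rw [hev.fderiv_eq, fderiv_const_add]
    rw [this, pd_mul (hqd a) (hLd f), hqX a y hy hf₀]
  -- The divergence ∇_a(ψX^a), with q^a differentiated in place of ψX^a.
  set Θ : ℝ := ∑ a, pd a (q a) y + ψ y * ∑ a, ∑ s, christoffel G a a s y * X s y with hΘ
  set N : Fin d → ℝ := fun b => ∑ c, X c y * pd c (X b) y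
    + ∑ c, ∑ e, christoffel G b c e y * X c y * X e y with hN
  have key : ∀ f, Θ * L f y + ψ y * ∑ b, G y f b * N b = 0 := by
    intro f
    have hlow := h.sum_lower_acceleration hy hX f
    have hd := hdiv f
    simp only [hpd, hP y hy, mul_add, Finset.sum_add_distrib] at hd
    -- The Λδ part of the Ricci tensor is divergence-free: both of its Christoffel terms equal
    -- ΛΓ^a_{af}.
    have t1 : ∑ a, ∑ s, christoffel G a a s y * (Λ * (1 : Matrix (Fin d) (Fin d) ℝ) s f)
        = ∑ a, ∑ s, christoffel G a f s y * (Λ * (1 : Matrix (Fin d) (Fin d) ℝ) s a) := by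
      refine Finset.sum_congr rfl fun a _ => ?_
      simp [Matrix.one_apply, h.christoffel_symm hy a a f]
    have t2 : ∑ a, ∑ s, christoffel G a a s y * (ψ y * (X s y * L f y))
        = ψ y * (∑ a, ∑ s, christoffel G a a s y * X s y) * L f y := by
      simp only [Finset.mul_sum, Finset.sum_mul]
      exact Finset.sum_congr rfl fun a _ => Finset.sum_congr rfl fun s _ => by ring
    have t3 : ∑ a, ∑ s, christoffel G a f s y * (ψ y * (X s y * L a y))
        = ψ y * ∑ a, ∑ s, christoffel G a f s y * (X s y * L a y) := by
      simp only [Finset.mul_sum]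
      exact Finset.sum_congr rfl fun a _ => Finset.sum_congr rfl fun s _ => by ring
    have t4 : ∑ a, ψ y * X a y * pd a (L f) y = ψ y * ∑ a, X a y * pd a (L f) y := by
      simp only [Finset.mul_sum, mul_assoc]
    rw [t1, t2, t3, t4, ← Finset.sum_mul] at hd
    rw [← hlow, hΘ]
    linear_combination hd
  refine ⟨-Θ / ψ y, fun a => ?_⟩
  have hvec : N = fun a => -Θ / ψ y * X a y := by
    refine h.eq_of_mulVec_eq hy (funext fun f => ?_)
    change ∑ b, G y f b * N b = ∑ b, G y f b * (-Θ / ψ y * X b y)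
    have hs : ∑ b, G y f b * (-Θ / ψ y * X b y) = -Θ / ψ y * L f y := by
      simp only [hL, Finset.mul_sum]
      exact Finset.sum_congr rfl fun b _ => by ring
    rw [hs]
    field_simp
    linear_combination key f
  exact congrFun hvec a

end IsMetricOn

end

/-! ### From the manifold to coordinates -/

section

variable {d : ℕ} {M : Type*} [TopologicalSpace M] [ChartedSpace (EuclideanSpace ℝ (Fin d)) M]
  {e : OpenPartialHomeomorph M (EuclideanSpace ℝ (Fin d))}

theorem mdifferentiable_of_mem_maximalAtlas (he : e ∈ IsManifold.maximalAtlas (𝓡 d) ∞ M) :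
    e.MDifferentiable (𝓡 d) (𝓡 d) :=
  ⟨(contMDiffOn_of_mem_maximalAtlas he).mdifferentiableOn (by simp),
    (contMDiffOn_symm_of_mem_maximalAtlas he).mdifferentiableOn (by simp)⟩

theorem coord_zero (e : OpenPartialHomeomorph M (EuclideanSpace ℝ (Fin d))) (p : M) :
    coord e p 0 = 0 :=
  map_zero (mfderiv (𝓡 d) (𝓡 d) e p)

theorem coord_mfderiv_symm (he : e ∈ IsManifold.maximalAtlas (𝓡 d) ∞ M)
    {y : EuclideanSpace ℝ (Fin d)} (hy : y ∈ e.target) (w : EuclideanSpace ℝ (Fin d)) :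
    coord e (e.symm y) (mfderiv (𝓡 d) (𝓡 d) e.symm y w) = w :=
  DFunLike.congr_fun ((mdifferentiable_of_mem_maximalAtlas he).comp_symm_deriv hy) w

theorem coord_injective (he : e ∈ IsManifold.maximalAtlas (𝓡 d) ∞ M) {p : M}
    (hp : p ∈ e.source) : Function.Injective (coord e p) :=
  (mdifferentiable_of_mem_maximalAtlas he).mfderiv_injective hp

theorem eq_sum_coord_smul_coordVec (he : e ∈ IsManifold.maximalAtlas (𝓡 d) ∞ M)
    {y : EuclideanSpace ℝ (Fin d)} (hy : y ∈ e.target) (u : TangentSpace (𝓡 d) (e.symm y)) :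
    u = ∑ a, coord e (e.symm y) u a • coordVec e y a := by
  apply coord_injective he (e.map_target hy)
  have h : ∑ a, coord e (e.symm y) u a • coordVec e y a
      = mfderiv (𝓡 d) (𝓡 d) e.symm y (coord e (e.symm y) u) := by
    have hw : coord e (e.symm y) u
        = ∑ a, coord e (e.symm y) u a • EuclideanSpace.single a (1 : ℝ) := by
      ext i; simp [Finset.sum_apply, Pi.single_apply]
    conv_rhs => rw [hw]
    exact (map_sum (mfderiv (𝓡 d) (𝓡 d) e.symm y : EuclideanSpace ℝ (Fin d) →L[ℝ] _) _ _).symm ▸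
      Finset.sum_congr rfl fun a _ => (map_smul (mfderiv (𝓡 d) (𝓡 d) e.symm y) _ _).symm
  rw [h, coord_mfderiv_symm he hy]

variable [IsManifold (𝓡 d) ∞ M]

/-- The field is the tangent map of the inverse chart applied to a constant section, and that
tangent map is smooth. -/
theorem contMDiffOn_mfderiv_symm (he : e ∈ IsManifold.maximalAtlas (𝓡 d) ∞ M)
    (w : EuclideanSpace ℝ (Fin d)) :
    ContMDiffOn (𝓡 d) (𝓡 d).tangent ∞
      (fun y => (⟨e.symm y, mfderiv (𝓡 d) (𝓡 d) e.symm y w⟩ : TangentBundle (𝓡 d) M))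
      e.target := by
  have : IsManifold (𝓡 d) 1 M := IsManifold.of_le (n := ∞) (by simp)
  have h1 := (contMDiffOn_symm_of_mem_maximalAtlas he).contMDiffOn_tangentMapWithin (m := ∞)
    (by simp) e.open_target.uniqueMDiffOn
  have h2 : ContMDiffOn (𝓡 d) (𝓡 d).tangent ∞
      (fun y => (⟨y, w⟩ : TangentBundle (𝓡 d) (EuclideanSpace ℝ (Fin d)))) e.target :=
    fun y _ => contMDiffWithinAt_vectorSpace_iff_contDiffWithinAt.2 contDiffWithinAt_const
  refine (h1.comp h2 fun y hy => hy).congr fun y hy => ?_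
  simp [tangentMapWithin, mfderivWithin_of_isOpen e.open_target hy]

/-- The components are the fibre part of the tangent map of the chart composed with the section X,
which is C¹ on V. -/
theorem differentiableAt_fieldComp (he : e ∈ IsManifold.maximalAtlas (𝓡 d) ∞ M) {V : Set M}
    (hV : IsOpen V) {X : (p : M) → TangentSpace (𝓡 d) p}
    (hX : ContMDiffOn (𝓡 d) (𝓡 d).tangent 1
      (fun p => (⟨p, X p⟩ : TangentBundle (𝓡 d) M)) V)
    {y : EuclideanSpace ℝ (Fin d)} (hy : y ∈ e.target) (hyV : e.symm y ∈ V) (a : Fin d) :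
    DifferentiableAt ℝ (fieldComp e X a) y := by
  have : IsManifold (𝓡 d) 1 M := IsManifold.of_le (n := ∞) (by simp)
  set O : Set (EuclideanSpace ℝ (Fin d)) := e.target ∩ e.symm ⁻¹' V
  have hO : IsOpen O := e.isOpen_inter_preimage_symm hV
  have h1 := (contMDiffOn_of_mem_maximalAtlas he).contMDiffOn_tangentMapWithin (m := 1)
    (WithTop.coe_le_coe.2 le_top) e.open_source.uniqueMDiffOn
  have h2 : ContMDiffOn (𝓡 d) (𝓡 d) 1 e.symm O :=
    ((contMDiffOn_symm_of_mem_maximalAtlas he).of_le (WithTop.coe_le_coe.2 le_top)).mono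
      Set.inter_subset_left
  have h3 := h1.comp (hX.comp h2 fun z hz => hz.2) fun z hz => e.map_target hz.1
  have h4 := ((contMDiff_snd_tangentBundle_modelSpace (EuclideanSpace ℝ (Fin d)) (𝓡 d)
    (n := 1)).comp_contMDiffOn h3).contDiffOn
  have h5 : DifferentiableAt ℝ (fun z => coord e (e.symm z) (X (e.symm z))) y := by
    refine ((h4.contDiffAt (hO.mem_nhds ⟨hy, hyV⟩)).differentiableAt
      (by simp)).congr_of_eventuallyEq ?_
    refine Set.EqOn.eventuallyEq_of_mem (fun z hz => ?_) (hO.mem_nhds ⟨hy, hyV⟩)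
    exact DFunLike.congr_fun
      (mfderivWithin_of_isOpen (I := 𝓡 d) (I' := 𝓡 d) (f := e) e.open_source
        (e.map_target hz.1)).symm (X (e.symm z))
  exact (EuclideanSpace.proj a).differentiableAt.comp y h5

namespace LorentzMetric

variable (g : LorentzMetric d M)

theorem inner_eq_sum_comp (he : e ∈ IsManifold.maximalAtlas (𝓡 d) ∞ M)
    {y : EuclideanSpace ℝ (Fin d)} (hy : y ∈ e.target) (u v : TangentSpace (𝓡 d) (e.symm y)) :
    g.inner (e.symm y) u v = ∑ a, ∑ b, g.comp e y a b
      * coord e (e.symm y) u a * coord e (e.symm y) v b := by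
  conv_lhs => rw [eq_sum_coord_smul_coordVec he hy u, eq_sum_coord_smul_coordVec he hy v]
  simp only [map_sum, map_smul, sum_apply, smul_apply,
    smul_eq_mul, Finset.mul_sum, comp, Matrix.of_apply]
  rw [Finset.sum_comm]
  exact Finset.sum_congr rfl fun a _ => Finset.sum_congr rfl fun b _ => by ring

/-- A nonzero vector in the radical would be orthogonal to the timelike t, so of positive square,
yet it is orthogonal to itself. -/
theorem eq_zero_of_inner_eq_zero {p : M} {v : TangentSpace (𝓡 d) p}
    (hv : ∀ u, g.inner p u v = 0) : v = 0 := by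
  obtain ⟨t, -, ht⟩ := g.lorentzian p
  by_contra h0
  exact (ht v h0 (hv t)).ne' (hv v)

theorem contDiffOn_comp (he : e ∈ IsManifold.maximalAtlas (𝓡 d) ∞ M) (a b : Fin d) :
    ContDiffOn ℝ ∞ (fun y => g.comp e y a b) e.target := by
  rw [← contMDiffOn_iff_contDiffOn]
  intro y hy
  have h : ContMDiffWithinAt (𝓡 d) ((𝓡 d).prod 𝓘(ℝ, ℝ)) ∞
      (fun z => Bundle.TotalSpace.mk' ℝ (E := Bundle.Trivial M ℝ) (e.symm z)
        (g.inner (e.symm z) (coordVec e z a) (coordVec e z b))) e.target y := by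
    apply ContMDiffWithinAt.clm_bundle_apply₂ (F₁ := EuclideanSpace ℝ (Fin d))
      (F₂ := EuclideanSpace ℝ (Fin d))
    · exact ContMDiffAt.comp_contMDiffWithinAt y g.contMDiff.contMDiffAt
        (contMDiffOn_symm_of_mem_maximalAtlas he y hy)
    · exact contMDiffOn_mfderiv_symm he _ y hy
    · exact contMDiffOn_mfderiv_symm he _ y hy
  simp only [Bundle.contMDiffWithinAt_totalSpace] at h
  exact h.2

theorem isMetricOn_comp (he : e ∈ IsManifold.maximalAtlas (𝓡 d) ∞ M) :
    IsMetricOn e.target (g.comp e) where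
  isOpen := e.open_target
  smooth := g.contDiffOn_comp he
  symm y _ := by ext a b; exact g.symm _ _ _
  det_ne_zero y hy hdet := by
    obtain ⟨w, hw0, hw⟩ := Matrix.exists_mulVec_eq_zero_iff.2 hdet
    have hc := coord_mfderiv_symm he hy (WithLp.toLp 2 w)
    have hv : mfderiv (𝓡 d) (𝓡 d) e.symm y (WithLp.toLp 2 w) = 0 := by
      apply g.eq_zero_of_inner_eq_zero
      intro u
      rw [g.inner_eq_sum_comp he hy, hc]
      refine Finset.sum_eq_zero fun a _ => ?_
      have ha : ∑ b, g.comp e y a b * w b = 0 := congrFun hw a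
      have : ∑ b, g.comp e y a b * coord e (e.symm y) u a * w b
          = coord e (e.symm y) u a * ∑ b, g.comp e y a b * w b := by
        rw [Finset.mul_sum]; exact Finset.sum_congr rfl fun b _ => by ring
      rw [ha, mul_zero] at this
      exact this
    rw [hv, coord_zero] at hc
    exact hw0 (funext fun a => (congrArg (fun x : EuclideanSpace ℝ (Fin d) => x a) hc).symm)

theorem ric_coordVec (he : e ∈ IsManifold.maximalAtlas (𝓡 d) ∞ M)
    {y : EuclideanSpace ℝ (Fin d)} (hy : y ∈ e.target) (a b : Fin d) :
    g.ric e (e.symm y) (coordVec e y a) (coordVec e y b) = ricci (g.comp e) a b y := by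
  have hc : ∀ i, coord e (e.symm y) (coordVec e y i) = EuclideanSpace.single i 1 := fun i =>
    coord_mfderiv_symm he hy _
  simp [ric, hc, e.right_inv hy]

theorem inner_coordVec (he : e ∈ IsManifold.maximalAtlas (𝓡 d) ∞ M)
    {y : EuclideanSpace ℝ (Fin d)} (hy : y ∈ e.target) (v : TangentSpace (𝓡 d) (e.symm y))
    (a : Fin d) : g.inner (e.symm y) v (coordVec e y a)
      = ∑ s, g.comp e y a s * coord e (e.symm y) v s := by
  have hc : ∀ i, coord e (e.symm y) (coordVec e y i) = EuclideanSpace.single i 1 := fun i =>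
    coord_mfderiv_symm he hy _
  rw [g.symm, g.inner_eq_sum_comp he hy, hc, Finset.sum_comm]
  simp

/-- A vector field along the null direction `k` of the Ricci tensor `Λ g + η k ⊗ k` is
geodetic. -/
theorem isGeodeticOn_of_hasRicciTensor {Λ : ℝ} {η : M → ℝ} {k : (p : M) → TangentSpace (𝓡 d) p}
    (hη : ∀ p, η p ≠ 0) (hk : ∀ p, g.IsNull p (k p)) (hRic : g.HasRicciTensor Λ η k)
    {V : Set M} (hV : IsOpen V) {l : (p : M) → TangentSpace (𝓡 d) p}
    (hl : ContMDiffOn (𝓡 d) (𝓡 d).tangent 1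
      (fun p => (⟨p, l p⟩ : TangentBundle (𝓡 d) M)) V)
    (hlk : ∀ p ∈ V, ∃ c : ℝ, c ≠ 0 ∧ l p = c • k p) : g.IsGeodeticOn l V := by
  intro p hpV e he hp
  obtain ⟨y, hy, rfl⟩ : ∃ y ∈ e.target, e.symm y = p := ⟨e p, e.map_source hp, e.left_inv hp⟩
  have hm := g.isMetricOn_comp he
  -- The chart domain is cut down to V, where ℓ is C¹ and parallel to k.
  have hmO : IsMetricOn (e.target ∩ e.symm ⁻¹' V) (g.comp e) :=
    ⟨e.isOpen_inter_preimage_symm hV, fun a b => (hm.smooth a b).mono Set.inter_subset_left,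
      fun z hz => hm.symm z hz.1, fun z hz => hm.det_ne_zero z hz.1⟩
  choose! c hc0 hc using hlk
  have hnull : ∀ z ∈ e.target ∩ e.symm ⁻¹' V, ∑ a, fieldComp e l a z *
      ∑ s, g.comp e z a s * fieldComp e l s z = 0 := by
    intro z hz
    have h0 : g.inner (e.symm z) (l (e.symm z)) (l (e.symm z)) = 0 := by
      simp [hc _ hz.2, (hk (e.symm z)).2]
    rw [g.inner_eq_sum_comp he hz.1] at h0
    rw [← h0]
    refine Finset.sum_congr rfl fun a _ => ?_
    rw [Finset.mul_sum]
    exact Finset.sum_congr rfl fun b _ => by simp only [fieldComp]; ring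
  have hne : ∃ a, fieldComp e l a y ≠ 0 := by
    by_contra! hall
    have h0 : coord e (e.symm y) (l (e.symm y)) = coord e (e.symm y) 0 := by
      rw [coord_zero]; ext a; exact hall a
    have hl0 := coord_injective he (e.map_target hy) h0
    rw [hc _ hpV] at hl0
    exact (smul_ne_zero (hc0 _ hpV) (hk (e.symm y)).1) hl0
  -- Substituting k = ℓ/c puts the factor 1/c² into ψ; c is a pointwise choice without regularity.
  have hψ : ∀ z ∈ e.target ∩ e.symm ⁻¹' V, ∀ a b, ricci (g.comp e) a b z
      = Λ * g.comp e z a b + η (e.symm z) / c (e.symm z) ^ 2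
        * (∑ s, g.comp e z a s * fieldComp e l s z)
        * ∑ s, g.comp e z b s * fieldComp e l s z := by
    intro z hz a b
    have hlow : ∀ a, ∑ s, g.comp e z a s * fieldComp e l s z
        = c (e.symm z) * g.inner (e.symm z) (k (e.symm z)) (coordVec e z a) := by
      intro a
      have := g.inner_coordVec he hz.1 (l (e.symm z)) a
      rw [hc _ hz.2, map_smul] at this
      simp only [fieldComp, hc _ hz.2]
      rw [← this]; rfl
    rw [← g.ric_coordVec he hz.1, hRic e he _ (e.map_target hz.1), hlow, hlow]
    have := hc0 _ hz.2
    simp only [comp, Matrix.of_apply]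
    field_simp
  obtain ⟨φ, hφ⟩ := hmO.acceleration_proportional ⟨hy, hpV⟩
    (fun a => differentiableAt_fieldComp he hV hl hy hpV a) hne
    (div_ne_zero (hη _) (pow_ne_zero 2 (hc0 _ hpV))) hnull hψ
  refine ⟨φ, fun a => ?_⟩
  simp only [covDeriv, e.right_inv hy]
  exact hφ a

/-- With ∇_ℓ ℓ = fℓ, the component κ_i equals f g(m_(i), ℓ), which vanishes in a null frame. -/
theorem IsGeodeticOn.kappaVanishesOn {l : (p : M) → TangentSpace (𝓡 d) p} {V : Set M}
    (h : g.IsGeodeticOn l V) : g.KappaVanishesOn l V := by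
  intro p hpV e he hp n m hframe i
  obtain ⟨f, hf⟩ := h p hpV e he hp
  have h0 := hframe.lm i
  rw [g.symm] at h0
  obtain ⟨y, hy, rfl⟩ : ∃ y ∈ e.target, e.symm y = p := ⟨e p, e.map_source hp, e.left_inv hp⟩
  rw [g.inner_eq_sum_comp he hy] at h0
  simp only [covDerivForm, hf, e.right_inv hy]
  rw [← mul_zero f, ← h0, Finset.mul_sum]
  refine Finset.sum_congr rfl fun a _ => ?_
  rw [Finset.mul_sum]
  exact Finset.sum_congr rfl fun b _ => by ring

end LorentzMetric

end

end Spacetime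

end

/-- Let `(M, g)` be a spacetime whose Weyl tensor is at every point of type III or N and whose Ricci
tensor is `Λ g_{ab} + η k_a k_b` with `k` null and `η` nowhere zero. Then every null vector field `ℓ`
that spans the direction of `k`, as a common aligned null direction of the Weyl and the Ricci tensor
does, is geodetic, `κ_i = 0`. The direction of `k` is not assumed to be aligned with the Weyl
tensor. -/
theorem proposition2 {d : ℕ} {M : Type*} [TopologicalSpace M]
    [ChartedSpace (EuclideanSpace ℝ (Fin d)) M] [IsManifold (𝓡 d) ∞ M]
    (g : Spacetime.LorentzMetric d M) (hWeyl : g.IsWeylTypeIIIOrN)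
    (Λ : ℝ) (η : M → ℝ) (k : (p : M) → TangentSpace (𝓡 d) p)
    (hη : ∀ p, η p ≠ 0) (hk : ∀ p, g.IsNull p (k p)) (hRic : g.HasRicciTensor Λ η k)
    (V : Set M) (hV : IsOpen V) (l : (p : M) → TangentSpace (𝓡 d) p)
    (hl : ContMDiffOn (𝓡 d) (𝓡 d).tangent 1
      (fun p => (⟨p, l p⟩ : TangentBundle (𝓡 d) M)) V)
    (hlk : ∀ p ∈ V, ∃ c : ℝ, c ≠ 0 ∧ l p = c • k p) :
    g.KappaVanishesOn l V ∧ g.IsGeodeticOn l V := by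
  have h := g.isGeodeticOn_of_hasRicciTensor hη hk hRic hV hl hlk
  exact ⟨Spacetime.LorentzMetric.IsGeodeticOn.kappaVanishesOn g h, h⟩
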